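/- **Setting.** An $m$-round protocol $\Pi=(\mathsf A,\mathsf B)$ consists of exactly $m$ one-bit messages. Its nodes are the bit strings (partial transcripts) of length at most $m$, its leaves those of length $m$. A control scheme says which party sends the next message at each non-leaf node $u$. The controlling party draws this bit from a distribution depending on $u$, and the common output $\chi_\Pi(\ell)\in\{0,1\}$ is a function of the full transcript $\ell$. Let $\langle\Pi\rangle$ be the distribution of the full transcript (leaf) of a random execution. For a node $u$ visited with positive probability, let $\mathrm{val}(\Pi_u)$ be the expected output of the protocol continued from $u$, and put $\mathrm{val}(\Pi_u)=0$ otherwise. Let $\mathrm{desc}(\mathcal S)$ be the set of nodes having an ancestor in $\mathcal S$ (each node is its own ancestor). Let $\mathrm{Low}^{\delta}_\Pi$ (resp. $\mathrm{High}^{\delta}_\Pi$) be the set of non-leaf nodes $u$ with $\mathrm{val}(\Pi_u)\le\delta$ (resp. $\ge 1-\delta$), and $\mathrm{Low}^{\delta,\mathsf A}_\Pi$ the set of nodes of $\mathrm{Low}^{\delta}_\Pi$ controlled by $\mathsf A$. $\mathrm{SD}$ denotes statistical distance. *Biased continuators.* $\mathsf{BiasedCont}_\Pi(u,b)$ samples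 $\ell\leftarrow\langle\Pi\rangle$ conditioned on $\ell\in\mathrm{desc}(u)$ and $\chi_\Pi(\ell)=b$, and returns the bit $\ell_{|u|+1}$ (its answer is arbitrary if the condition has probability $0$). A randomized algorithm $\mathsf C$ is a $(\xi,\delta)$-biased-continuator of $\Pi$ if $$\Pr_{\ell\leftarrow\langle\Pi\rangle}\bigl[\exists\, 0\le i\le m-1:\ \mathrm{SD}\bigl(\mathsf C(\ell_{1,\dots,i},1),\mathsf{BiasedCont}_\Pi(\ell_{1,\dots,i},1)\bigr)>\xi\ \wedge\ \ell_{1,\dots,i}\notin \mathrm{Low}^{\delta}_\Pi\bigr]\le\xi$$ and the same holds with the bit $1$ replaced by $0$ and $\mathrm{Low}^{\delta}_\Pi$ replaced by $\mathrm{High}^{\delta}_\Pi$. For every protocol $\Pi$ let $\mathsf{BiasedCont}^{\xi,\delta}_\Pi$ be an arbitrary but fixed $(\xi,\delta)$-biased-continuator of $\Pi$. *Attackers.* Let $\mathsf A^{(0)}_\Pi=\mathsf A$ and, for $i>0$, let $\mathsf A^{(i)}_\Pi$ send on transcript $u$ the message $\mathsf{BiasedCont}_{(\mathsf A^{(i-1)}_\Pi,\mathsf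 B)}(u,1)$. Let $\mathsf A^{(0,\xi,\delta)}_\Pi=\mathsf A$ and, for $i>0$, let $\mathsf A^{(i,\xi,\delta)}_\Pi$ send on transcript $u$ the message $\mathsf{BiasedCont}^{\xi,\delta}_{(\mathsf A^{(i-1,\xi,\delta)}_\Pi,\mathsf B)}(u,1)$. Replacing $\mathsf A$ by an attacker changes neither the control scheme nor the common-output function. **Statement.** For any $\delta\in(0,1/4]$ and $k\in\mathbb N=\{0,1,2,\dots\}$ there is a real polynomial $p_{k,\delta}$ in three variables such that the following holds. Let $\Pi=(\mathsf A,\mathsf B)$ be an $m$-round protocol, and assume that $$\Pr_{\ell\leftarrow\langle\Pi\rangle}\bigl[\ell\in\mathrm{desc}\bigl(\mathrm{Low}^{1.5\delta',\mathsf A}_\Pi\bigr)\bigr]\le\alpha$$ for some $\delta'$ with $\delta\le\delta'\le\frac14$. Then for any $\xi,\mu\in(0,1)$, $$\mathrm{SD}\Bigl(\langle\mathsf A^{(k)}_\Pi,\mathsf B\rangle,\ \langle\mathsf A^{(k,\xi,\delta')}_\Pi,\mathsf B\rangle\Bigr)\ \le\ (\alpha+\xi)\cdot p_{k,\delta}(m,1/\delta',1/\mu)+\mu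 .$$ -/

import Mathlib

namespace CoinFlip

/-- The probability of the event `s` under the distribution `p`, as a real number. -/
noncomputable def prob {α : Type} (p : PMF α) (s : Set α) : ℝ :=
  (p.toOuterMeasure s).toReal

/-- Statistical distance of two distributions over a finite set. -/
noncomputable def statDist {α : Type} [Fintype α] (p q : PMF α) : ℝ :=
  (1 / 2) * ∑ a, |(p a).toReal - (q a).toReal|

/-- The two parties: `A` is the left-hand party, `B` the right-hand party. -/
inductive Party : Type
  | A
  | B

/-- A (stateless, randomized) strategy of a party: given the transcript so far, the
distribution of the next message, which is one bit. -/
abbrev Strategy : Type := List Bool → PMF Bool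

/-- An `m`-round two-party protocol `(A, B)` with single-bit messages and with a common output
bit. Vertices of the complete binary tree of height `m` are bit strings of length at most `m`:
inner nodes have length `< m`, leaves have length `m`. Only `ctrl u`, `alice u`, `bob u` at inner
nodes `u` and `out u` at leaves `u` are ever relevant. -/
structure Protocol (m : ℕ) where
  /-- control scheme: who sends the next message after transcript `u` -/
  ctrl : List Bool → Party
  /-- the left-hand party `A` -/
  alice : Strategy
  /-- the right-hand party `B` -/
  bob : Strategy
  /-- the common output, a function of the full transcript -/
  out : List Bool → Bool

/-- The leaves of the tree of height `m`, i.e. the full transcripts. The corresponding bit string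
is `List.ofFn ℓ`. -/
abbrev Leaf (m : ℕ) : Type := Fin m → Bool

namespace Protocol

variable {m : ℕ}

/-- The edge distribution at node `u`: the message of the party that controls `u`. -/
noncomputable def next (P : Protocol m) (u : List Bool) : PMF Bool :=
  match P.ctrl u with
  | Party.A => P.alice u
  | Party.B => P.bob u

/-- The protocol induced on the subtree rooted at `u` (with `n` remaining rounds). -/
def subtree (P : Protocol m) (u : List Bool) (n : ℕ) : Protocol n where
  ctrl v := P.ctrl (u ++ v)
  alice v := P.alice (u ++ v)
  bob v := P.bob (u ++ v)
  out v := P.out (u ++ v)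

/-- The leaf distribution: the full transcript of a random execution. -/
noncomputable def leafDist : {m : ℕ} → Protocol m → PMF (Leaf m)
  | 0, _ => PMF.pure Fin.elim0
  | n + 1, P => (P.next []).bind fun b =>
      ((P.subtree [b] n).leafDist).map (fun ℓ => (Fin.cons b ℓ : Leaf (n + 1)))

/-- The value of a protocol: the expectation of its common output. -/
noncomputable def val (P : Protocol m) : ℝ :=
  prob P.leafDist {ℓ | P.out (List.ofFn ℓ) = true}

/-- The probability that a random execution visits the node `u`. -/
noncomputable def visit (P : Protocol m) (u : List Bool) : ℝ :=
  prob P.leafDist {ℓ | u <+: List.ofFn ℓ}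

open Classical in
/-- The value of the sub-protocol at `u`; if `u` is visited with probability zero, the
sub-protocol is the undefined protocol, whose value is `0` by convention. -/
noncomputable def valAt (P : Protocol m) (u : List Bool) : ℝ :=
  if 0 < P.visit u then (P.subtree u (m - u.length)).val else 0

/-- The `δ`-low-value nodes. -/
def low (P : Protocol m) (δ : ℝ) : Set (List Bool) :=
  {u | u.length < m ∧ P.valAt u ≤ δ}

/-- The `δ`-high-value nodes. -/
def high (P : Protocol m) (δ : ℝ) : Set (List Bool) :=
  {u | u.length < m ∧ 1 - δ ≤ P.valAt u}

/-- The `δ`-low-value nodes controlled by `A`. -/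
def lowA (P : Protocol m) (δ : ℝ) : Set (List Bool) :=
  P.low δ ∩ {u | P.ctrl u = Party.A}

/-- Replace the left-hand party by the strategy `σ`; the other party, the control scheme and the
common output stay the same. -/
def withAlice (P : Protocol m) (σ : Strategy) : Protocol m where
  ctrl := P.ctrl
  alice := σ
  bob := P.bob
  out := P.out

end Protocol

/-- Descendants, in the tree of height `m`, of the nodes in `U` (each node is a descendant of
itself). -/
def desc (m : ℕ) (U : Set (List Bool)) : Set (List Bool) :=
  {v | v.length ≤ m ∧ ∃ u ∈ U, u <+: v}

/-- The output distribution of a randomized algorithm that, on a transcript and a bit, returns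
a message. -/
abbrev Continuator : Type := List Bool → Bool → PMF Bool

open Classical in
/-- The (ideal) biased continuator of `P`: on an inner node `u` and a bit `b`, choose a leaf from
the leaf distribution of `P`, conditioned on being a descendant of `u` and having output `b`, and
return its bit number `u.length + 1`. If no leaf satisfies the condition (with positive
probability), the answer is arbitrary; these arbitrary answers are given by `fb`. -/
noncomputable def biasedCont {m : ℕ} (fb : Protocol m → Continuator) (P : Protocol m) :
    Continuator := fun u b =>
  if h : ∃ ℓ ∈ {ℓ : Leaf m | u <+: List.ofFn ℓ ∧ P.out (List.ofFn ℓ) = b},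
      ℓ ∈ P.leafDist.support then
    (P.leafDist.filter {ℓ : Leaf m | u <+: List.ofFn ℓ ∧ P.out (List.ofFn ℓ) = b} h).map
      (fun ℓ => (List.ofFn ℓ).getD u.length false)
  else fb P u b

/-- `C` is a `(ξ, δ)`-biased-continuator of `P`. For a leaf `ℓ`, the string
`(List.ofFn ℓ).take i` is the transcript of the first `i` rounds. -/
def IsApproxBiasedCont {m : ℕ} (fb : Protocol m → Continuator) (ξ δ : ℝ) (P : Protocol m)
    (C : Continuator) : Prop :=
  prob P.leafDist {ℓ | ∃ i < m,
      ξ < statDist (C ((List.ofFn ℓ).take i) true)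
        (biasedCont fb P ((List.ofFn ℓ).take i) true) ∧
      (List.ofFn ℓ).take i ∉ P.low δ} ≤ ξ ∧
  prob P.leafDist {ℓ | ∃ i < m,
      ξ < statDist (C ((List.ofFn ℓ).take i) false)
        (biasedCont fb P ((List.ofFn ℓ).take i) false) ∧
      (List.ofFn ℓ).take i ∉ P.high δ} ≤ ξ

/-- The recursive biased-continuation attacker for the left-hand party that uses the continuator
`cont Q` when it attacks the protocol `Q`: level `0` is `A`, and level `i + 1` sends on
transcript `u` the answer of the continuator of `(level i attacker, B)` on `(u, 1)`. -/
noncomputable def recAttacker {m : ℕ} (cont : Protocol m → Continuator) (P : Protocol m) :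
    ℕ → Strategy
  | 0 => P.alice
  | i + 1 => fun u => cont (P.withAlice (recAttacker cont P i)) u true

/-- The ideal recursive biased-continuation attacker. -/
noncomputable def idealAttacker {m : ℕ} (fb : Protocol m → Continuator) (P : Protocol m)
    (k : ℕ) : Strategy :=
  recAttacker (biasedCont fb) P k

end CoinFlip

namespace CoinFlip

/-! Write `L` for the `A`-controlled nodes of `P`-value at most `3d/2`, where `d` is the parameter
of the continuators. By induction on the level, two quantities are kept small together: the
probability that the ideal attacker visits `L`, and the distance of the ideal and the approximate
leaf distributions, measured by bounded test functions.

Passing to the next level has two ingredients. The first is a change of measure (`mul_ev_biased_le`,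
`ev_attacked_succ_le`). The new ideal attacker multiplies the probability of each of its moves by
`V(child)/V(u)`, where `V` is the current value. Because `B`'s moves are not reweighted, these
factors do not telescope, and the likelihood ratio `Z` has no useful uniform bound. However, before
`L` is visited the ideal attackers never fall below the `P`-value (`value_le_value_attacked`), so `V
> 3d/2` wherever the ratio changes. For small `r` this makes `Z^(1+r) * (2 - V)` a supermartingale,
so `Z` has a bounded moment of order `1 + r`. With `r = 1/N`, an event at level `i + 1` costs at
most `s^N` times its probability (together with that of visiting `L`) at level `i`, plus `2/s`.

The second is a one-step comparison (`ev_step_sub_le`), carried out under the level `i` ideal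
process, where the induction hypothesis applies: away from `L`, the ideal continuator of the ideal
attack and the approximate continuator of the approximate attack rarely differ much. The change of
measure moves this estimate to level `i + 1`, and the hybrid bound `abs_ev_sub_le` sums it over the
rounds.

Since `N` depends only on `δ`, and `s` and the `μ` of the previous level are chosen from `m`, `1/d`,
`1/μ`, every level keeps a polynomial bound. -/

/-- The expectation of `f` at the node reached after `n` further steps from `u`, when the edge
distributions are given by `q`. -/
noncomputable def ev (q : List Bool → Bool → ℝ) : ℕ → List Bool → (List Bool → ℝ) → ℝ
  | 0, u, f => f u
  | n + 1, u, f => q u true * ev q n (u ++ [true]) f + q u false * ev q n (u ++ [false]) f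

/-- `q` assigns to every node a probability distribution on the two outgoing edges. -/
structure IsKernel (q : List Bool → Bool → ℝ) : Prop where
  nonneg : ∀ u b, 0 ≤ q u b
  sum_eq_one : ∀ u, q u true + q u false = 1

/-- The probability of following the string `v`, starting at the node `u`. -/
noncomputable def reach (q : List Bool → Bool → ℝ) : List Bool → List Bool → ℝ
  | _, [] => 1
  | u, b :: v => q u b * reach q (u ++ [b]) v

/-! ### Expectations along random paths in the binary tree. -/

section Kernel

variable {q : List Bool → Bool → ℝ}

lemma IsKernel.le_one (hq : IsKernel q) (u : List Bool) (b : Bool) : q u b ≤ 1 := by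
  have h1 := hq.sum_eq_one u
  have h2 := hq.nonneg u true
  have h3 := hq.nonneg u false
  cases b <;> linarith

lemma ev_add (n : ℕ) (u : List Bool) (f g : List Bool → ℝ) :
    ev q n u (fun x => f x + g x) = ev q n u f + ev q n u g := by
  induction n generalizing u with
  | zero => rfl
  | succ n ih => simp only [ev, ih]; ring

lemma ev_const_mul (n : ℕ) (u : List Bool) (c : ℝ) (f : List Bool → ℝ) :
    ev q n u (fun x => c * f x) = c * ev q n u f := by
  induction n generalizing u with
  | zero => rfl
  | succ n ih => simp only [ev, ih]; ring

lemma ev_sub (n : ℕ) (u : List Bool) (f g : List Bool → ℝ) :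
    ev q n u (fun x => f x - g x) = ev q n u f - ev q n u g := by
  induction n generalizing u with
  | zero => rfl
  | succ n ih => simp only [ev, ih]; ring

lemma ev_const (hq : IsKernel q) (n : ℕ) (u : List Bool) (c : ℝ) :
    ev q n u (fun _ => c) = c := by
  induction n generalizing u with
  | zero => rfl
  | succ n ih => simp only [ev, ih, ← add_mul, hq.sum_eq_one, one_mul]

lemma ev_comp (j n : ℕ) (u : List Bool) (f : List Bool → ℝ) :
    ev q (j + n) u f = ev q j u (fun x => ev q n x f) := by
  induction j generalizing u with
  | zero => simp [ev]
  | succ j ih => rw [Nat.succ_add]; simp only [ev, ih]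

lemma ev_shift (w : List Bool) (n : ℕ) (u : List Bool) (f : List Bool → ℝ) :
    ev (fun v => q (w ++ v)) n u (fun x => f (w ++ x)) = ev q n (w ++ u) f := by
  induction n generalizing u with
  | zero => rfl
  | succ n ih => simp only [ev, ih, List.append_assoc]

/-- Monotonicity of the expectation. It suffices to compare the two functions at the descendants
that satisfy a property inherited along the edges of positive probability. -/
lemma ev_le_ev_of_invariant (hq : IsKernel q) {S : List Bool → Prop}
    (hS : ∀ u b, S u → 0 < q u b → S (u ++ [b])) {n : ℕ} {u : List Bool} {f g : List Bool → ℝ}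
    (hu : S u) (h : ∀ x, S x → x.length = u.length + n → u <+: x → f x ≤ g x) :
    ev q n u f ≤ ev q n u g := by
  induction n generalizing u with
  | zero => exact h u hu rfl (List.prefix_refl u)
  | succ n ih =>
    have key : ∀ b, q u b * ev q n (u ++ [b]) f ≤ q u b * ev q n (u ++ [b]) g := by
      intro b
      rcases (hq.nonneg u b).eq_or_lt with h0 | h0
      · rw [← h0]; simp
      · refine mul_le_mul_of_nonneg_left (ih (hS u b hu h0) fun x hx hl hp => ?_) h0.le
        refine h x hx ?_ ((List.prefix_append _ _).trans hp)
        simp at hl; omega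
    exact add_le_add (key true) (key false)

lemma ev_mono_of_prefix (hq : IsKernel q) {n : ℕ} {u : List Bool} {f g : List Bool → ℝ}
    (h : ∀ x, x.length = u.length + n → u <+: x → f x ≤ g x) : ev q n u f ≤ ev q n u g :=
  ev_le_ev_of_invariant hq (S := fun _ => True) (fun _ _ _ _ => trivial) trivial
    fun x _ => h x

lemma ev_mono (hq : IsKernel q) {n : ℕ} {u : List Bool} {f g : List Bool → ℝ}
    (h : ∀ x, f x ≤ g x) : ev q n u f ≤ ev q n u g :=
  ev_mono_of_prefix hq fun x _ _ => h x

lemma ev_nonneg (hq : IsKernel q) {n : ℕ} {u : List Bool} {f : List Bool → ℝ}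
    (h : ∀ x, 0 ≤ f x) : 0 ≤ ev q n u f := by
  rw [← ev_const hq n u 0]; exact ev_mono hq h

lemma ev_le_one (hq : IsKernel q) {n : ℕ} {u : List Bool} {f : List Bool → ℝ}
    (h : ∀ x, f x ≤ 1) : ev q n u f ≤ 1 := by
  rw [← ev_const hq n u 1]; exact ev_mono hq h

lemma abs_ev_le_one (hq : IsKernel q) {n : ℕ} {u : List Bool} {f : List Bool → ℝ}
    (h : ∀ x, |f x| ≤ 1) : |ev q n u f| ≤ 1 := by
  rw [abs_le]
  constructor
  · rw [← ev_const hq n u (-1)]; exact ev_mono hq fun x => (abs_le.1 (h x)).1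
  · exact ev_le_one hq fun x => (abs_le.1 (h x)).2

lemma ev_congr_of_invariant (hq : IsKernel q) {S : List Bool → Prop}
    (hS : ∀ u b, S u → 0 < q u b → S (u ++ [b])) {n : ℕ} {u : List Bool} {f g : List Bool → ℝ}
    (hu : S u) (h : ∀ x, S x → x.length = u.length + n → u <+: x → f x = g x) :
    ev q n u f = ev q n u g :=
  le_antisymm (ev_le_ev_of_invariant hq hS hu fun x h1 h2 h3 => (h x h1 h2 h3).le)
    (ev_le_ev_of_invariant hq hS hu fun x h1 h2 h3 => (h x h1 h2 h3).ge)

lemma ev_congr_of_prefix (hq : IsKernel q) {n : ℕ} {u : List Bool} {f g : List Bool → ℝ}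
    (h : ∀ x, x.length = u.length + n → u <+: x → f x = g x) : ev q n u f = ev q n u g :=
  ev_congr_of_invariant hq (S := fun _ => True) (fun _ _ _ _ => trivial) trivial fun x _ => h x

/-- Conditioning on the first `j` of `m` steps. -/
lemma ev_take_mul (hq : IsKernel q) {j m : ℕ} (hj : j ≤ m) (s f : List Bool → ℝ) :
    ev q m [] (fun x => s (x.take j) * f x) =
      ev q j [] (fun u => s u * ev q (m - j) u f) := by
  obtain ⟨n, rfl⟩ := Nat.exists_eq_add_of_le hj
  rw [ev_comp, Nat.add_sub_cancel_left]
  refine ev_congr_of_prefix hq fun u hu _ => ?_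
  rw [← ev_const_mul]
  refine ev_congr_of_prefix hq fun x _ hx => ?_
  have : x.take j = u := by
    simp at hu
    rw [← hu]; exact (List.prefix_iff_eq_take.1 hx).symm
  rw [this]

lemma ev_take (hq : IsKernel q) {j m : ℕ} (hj : j ≤ m) (s : List Bool → ℝ) :
    ev q m [] (fun x => s (x.take j)) = ev q j [] s := by
  have := ev_take_mul hq hj s (fun _ => 1)
  simpa [ev_const hq] using this

lemma reach_append (u v : List Bool) (b : Bool) :
    reach q u (v ++ [b]) = reach q u v * q (u ++ v) b := by
  induction v generalizing u with
  | nil => simp [reach]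
  | cons c v ih => simp [reach, ih, mul_assoc]

lemma reach_pos_append (u : List Bool) (b : Bool) (hu : 0 < reach q [] u) (hb : 0 < q u b) :
    0 < reach q [] (u ++ [b]) := by
  rw [reach_append]; exact mul_pos hu hb

open Classical in
lemma ev_prefix_mul (w v : List Bool) (n : ℕ) (hv : v.length ≤ n) (f : List Bool → ℝ)
    (hq : IsKernel q) :
    ev q n w (fun x => (if w ++ v <+: x then 1 else 0) * f x) =
      reach q w v * ev q (n - v.length) (w ++ v) f := by
  induction v generalizing w n with
  | nil =>
    simp only [List.append_nil, reach, List.length_nil, Nat.sub_zero, one_mul]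
    refine ev_congr_of_prefix hq fun x _ hx => ?_
    simp [hx]
  | cons b v ih =>
    obtain ⟨n, rfl⟩ : ∃ k, n = k + 1 := ⟨n - 1, by simp at hv; omega⟩
    have h1 : ∀ c, ev q n (w ++ [c]) (fun x => (if w ++ b :: v <+: x then 1 else 0) * f x) =
        if c = b then reach q (w ++ [b]) v * ev q (n - v.length) (w ++ b :: v) f else 0 := by
      intro c
      split_ifs with hc
      · subst hc
        have := ih (w ++ [c]) n (by simpa using hv)
        simpa using this
      · refine (ev_congr_of_prefix hq (g := fun _ => 0) fun x _ hx => ?_).trans (ev_const hq n _ 0)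
        rw [if_neg, zero_mul]
        intro hx'
        have h2 : w ++ [b] <+: x := (by simp : w ++ [b] <+: w ++ b :: v).trans hx'
        have h3 := List.prefix_of_prefix_length_le hx h2 (by simp)
        have h4 := h3.eq_of_length (by simp)
        simp at h4
        exact hc h4
    simp only [ev, h1, reach, List.length_cons, Nat.add_sub_add_right]
    cases b <;> simp <;> ring

end Kernel

/-! ### Leaf distributions, values and biased continuators as tree expectations. -/

/-- The real-valued edge distributions of a protocol. -/
noncomputable def Protocol.step {m : ℕ} (P : Protocol m) (u : List Bool) (b : Bool) : ℝ :=
  (P.next u b).toReal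

lemma pmf_bool_sum (p : PMF Bool) : (p true).toReal + (p false).toReal = 1 := by
  rw [← ENNReal.toReal_add (p.apply_ne_top _) (p.apply_ne_top _)]
  have := p.tsum_coe
  rw [tsum_fintype, Fintype.sum_bool] at this
  rw [this]; rfl

lemma statDist_bool (p r : PMF Bool) :
    statDist p r = |(p true).toReal - (r true).toReal| := by
  have h1 := pmf_bool_sum p
  have h2 := pmf_bool_sum r
  have h3 : (p false).toReal - (r false).toReal = -((p true).toReal - (r true).toReal) := by
    linarith
  rw [statDist, Fintype.sum_bool, h3, abs_neg]; ring

variable {m : ℕ}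

lemma Protocol.isKernel_step (P : Protocol m) : IsKernel P.step :=
  ⟨fun _ _ => ENNReal.toReal_nonneg, fun _ => pmf_bool_sum _⟩

lemma leafDist_cons {n : ℕ} (P : Protocol (n + 1)) (b : Bool) (ℓ : Leaf n) :
    P.leafDist (Fin.cons b ℓ : Leaf (n + 1)) = P.next [] b * (P.subtree [b] n).leafDist ℓ := by
  classical
  simp only [Protocol.leafDist, PMF.bind_apply, PMF.map_apply, tsum_fintype, Fintype.sum_bool]
  have h : ∀ (c : Bool) (ℓ' : Leaf n), ((Fin.cons b ℓ : Leaf (n + 1)) = Fin.cons c ℓ') ↔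
      (b = c ∧ ℓ = ℓ') := fun c ℓ' => Fin.cons_inj
  simp only [h]
  cases b <;> simp

lemma sum_leafDist_mul (P : Protocol m) (f : List Bool → ℝ) :
    ∑ ℓ, (P.leafDist ℓ).toReal * f (List.ofFn ℓ) = ev P.step m [] f := by
  induction m generalizing f with
  | zero =>
    simp only [Protocol.leafDist, ev, PMF.pure_apply, Fintype.sum_unique, List.ofFn_zero]
    rw [if_pos (Subsingleton.elim _ _), ENNReal.toReal_one, one_mul]
  | succ n ih =>
    rw [← (Fin.consEquiv (fun _ : Fin (n + 1) => Bool)).sum_comp, Fintype.sum_prod_type]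
    have h : ∀ b : Bool, ∑ ℓ : Leaf n,
        (P.leafDist (Fin.cons b ℓ : Leaf (n + 1))).toReal *
          f (List.ofFn (Fin.cons b ℓ : Leaf (n + 1))) =
        P.step [] b * ev P.step n [b] f := by
      intro b
      have h1 := ih (P.subtree [b] n) (fun x => f ([b] ++ x))
      have h2 := ev_shift (q := P.step) [b] n [] f
      have h3 : (P.subtree [b] n).step = fun v => P.step ([b] ++ v) := rfl
      rw [h3, h2] at h1
      simp only [List.append_nil] at h1
      rw [← h1, Finset.mul_sum]
      refine Finset.sum_congr rfl fun ℓ _ => ?_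
      rw [leafDist_cons, ENNReal.toReal_mul, List.ofFn_succ]
      simp [Protocol.step, mul_assoc]
    simp only [Fintype.sum_bool]
    exact congrArg₂ (· + ·) (h true) (h false)

open Classical in
lemma prob_eq_sum {α : Type} [Fintype α] (p : PMF α) (s : Set α) :
    prob p s = ∑ a, (p a).toReal * (if a ∈ s then 1 else 0) := by
  rw [prob, PMF.toOuterMeasure_apply_fintype, ENNReal.toReal_sum]
  · refine Finset.sum_congr rfl fun a _ => ?_
    by_cases h : a ∈ s <;> simp [h]
  · intro a _
    by_cases h : a ∈ s <;> simp [h, p.apply_ne_top]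

open Classical in
lemma prob_leafDist (P : Protocol m) (X : List Bool → Prop) :
    prob P.leafDist {ℓ | X (List.ofFn ℓ)} = ev P.step m [] (fun x => if X x then 1 else 0) := by
  rw [prob_eq_sum, ← sum_leafDist_mul]
  rfl

/-- The output of a protocol, as a real number. -/
def Protocol.outR (P : Protocol m) (x : List Bool) : ℝ := if P.out x = true then 1 else 0

/-- The value of the subprotocol at `u`, whether or not `u` is visited. -/
noncomputable def Protocol.value (P : Protocol m) (u : List Bool) : ℝ :=
  ev P.step (m - u.length) u P.outR

lemma Protocol.outR_nonneg (P : Protocol m) (x : List Bool) : 0 ≤ P.outR x := by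
  unfold outR; split_ifs <;> norm_num

lemma Protocol.outR_le_one (P : Protocol m) (x : List Bool) : P.outR x ≤ 1 := by
  unfold outR; split_ifs <;> norm_num

lemma Protocol.value_nonneg (P : Protocol m) (u : List Bool) : 0 ≤ P.value u :=
  ev_nonneg P.isKernel_step P.outR_nonneg

lemma Protocol.value_le_one (P : Protocol m) (u : List Bool) : P.value u ≤ 1 :=
  ev_le_one P.isKernel_step P.outR_le_one

lemma Protocol.value_eq (P : Protocol m) {u : List Bool} (hu : u.length < m) :
    P.value u = P.step u true * P.value (u ++ [true]) +
      P.step u false * P.value (u ++ [false]) := by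
  obtain ⟨n, hn⟩ : ∃ n, m - u.length = n + 1 := ⟨m - u.length - 1, by omega⟩
  have h : ∀ b : Bool, m - (u ++ [b]).length = n := fun b => by simp; omega
  simp only [value, h, hn, ev]

lemma Protocol.subtree_val (P : Protocol m) (u : List Bool) :
    (P.subtree u (m - u.length)).val = P.value u := by
  have h := prob_leafDist (P.subtree u (m - u.length))
    (fun x => (P.subtree u (m - u.length)).out x = true)
  rw [val, h, value]
  have h2 := ev_shift (q := P.step) u (m - u.length) [] P.outR
  rw [List.append_nil] at h2
  rw [← h2]
  congr 1
  ext x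
  simp only [outR, subtree]
  congr

lemma Protocol.visit_eq (P : Protocol m) {u : List Bool} (hu : u.length ≤ m) :
    P.visit u = reach P.step [] u := by
  classical
  have h := prob_leafDist P (fun x => u <+: x)
  have h2 := ev_prefix_mul (q := P.step) [] u m hu (fun _ => 1) P.isKernel_step
  rw [ev_const P.isKernel_step] at h2
  simp only [List.nil_append, mul_one] at h2
  rw [visit, h, ← h2]
  refine congrArg _ (funext fun x => ?_)
  congr

lemma Protocol.valAt_eq (P : Protocol m) {u : List Bool} (hu : u.length ≤ m)
    (h : 0 < reach P.step [] u) : P.valAt u = P.value u := by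
  rw [valAt, P.visit_eq hu, if_pos h, P.subtree_val]

lemma Protocol.valAt_le_value (P : Protocol m) {u : List Bool} : P.valAt u ≤ P.value u := by
  rw [valAt, P.subtree_val]
  split_ifs
  exacts [le_rfl, P.value_nonneg u]

lemma Protocol.valAt_nonneg (P : Protocol m) {u : List Bool} : 0 ≤ P.valAt u := by
  rw [valAt, P.subtree_val]
  split_ifs
  exacts [P.value_nonneg u, le_rfl]

lemma prob_prefix_out (P : Protocol m) {u : List Bool} (hu : u.length ≤ m) :
    prob P.leafDist {ℓ | u <+: List.ofFn ℓ ∧ P.out (List.ofFn ℓ) = true} =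
      reach P.step [] u * P.value u := by
  classical
  rw [prob_leafDist P (fun x => u <+: x ∧ P.out x = true)]
  have h2 := ev_prefix_mul (q := P.step) [] u m hu P.outR P.isKernel_step
  simp only [List.nil_append] at h2
  rw [Protocol.value, ← h2]
  congr 1
  ext x
  by_cases h : u <+: x <;> simp [h, Protocol.outR]

lemma prefix_getD_iff {u x : List Bool} (b : Bool) (h : u.length < x.length) :
    u <+: x ∧ x.getD u.length false = b ↔ u ++ [b] <+: x := by
  constructor
  · rintro ⟨⟨v, rfl⟩, hb⟩
    cases v with
    | nil => simp at h
    | cons c v => simp at hb; subst hb; simp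
  · rintro ⟨v, rfl⟩
    simp

/-- The definition of conditional probability with the denominator cleared, so that no division in
`ENNReal` survives. -/
lemma prob_map_filter {α : Type} [Fintype α] (p : PMF α) (s : Set α)
    (h : ∃ a ∈ s, a ∈ p.support) (f : α → Bool) (b : Bool) :
    prob p s * (((p.filter s h).map f) b).toReal = prob p {a | a ∈ s ∧ f a = b} := by
  classical
  have h0 : p.toOuterMeasure s ≠ 0 := by
    obtain ⟨a, ha, ha'⟩ := h
    intro h0
    rw [PMF.toOuterMeasure_apply_eq_zero_iff] at h0
    exact Set.disjoint_left.1 h0 ha' ha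
  have htop : p.toOuterMeasure s ≠ ⊤ := by
    rw [PMF.toOuterMeasure_apply]
    exact p.tsum_coe_indicator_ne_top s
  rw [PMF.map_apply, prob, prob, ← ENNReal.toReal_mul, tsum_fintype, Finset.mul_sum,
    PMF.toOuterMeasure_apply_fintype p {a | a ∈ s ∧ f a = b}]
  congr 1
  refine Finset.sum_congr rfl fun a _ => ?_
  rw [PMF.filter_apply, ← PMF.toOuterMeasure_apply]
  by_cases hb : f a = b
  · by_cases hs : a ∈ s
    · rw [if_pos hb.symm, Set.indicator_of_mem hs, mul_left_comm,
        ENNReal.mul_inv_cancel h0 htop, mul_one, Set.indicator_of_mem]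
      exact ⟨hs, hb⟩
    · simp [hs, hb]
  · simp [hb, Ne.symm hb]

/-- The defining property of the biased continuator, at visited nodes. -/
lemma value_mul_biasedCont (fb : Protocol m → Continuator) (P : Protocol m) {u : List Bool}
    (hu : u.length < m) (hr : 0 < reach P.step [] u) (b : Bool) :
    P.value u * (biasedCont fb P u true b).toReal = P.step u b * P.value (u ++ [b]) := by
  classical
  have hv := P.value_eq hu
  rcases (P.value_nonneg u).eq_or_lt with h0 | h0
  -- At value zero the continuator's answer is arbitrary, but both sides vanish: the two nonnegative
  -- terms of `hv` sum to zero.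
  · have h1 : ∀ b, 0 ≤ P.step u b * P.value (u ++ [b]) := fun b =>
      mul_nonneg (P.isKernel_step.nonneg u b) (P.value_nonneg _)
    have ht := h1 true
    have hf := h1 false
    rw [← h0, zero_mul]
    cases b <;> linarith
  · have hpos : 0 < prob P.leafDist {ℓ | u <+: List.ofFn ℓ ∧ P.out (List.ofFn ℓ) = true} := by
      rw [prob_prefix_out P hu.le]; exact mul_pos hr h0
    have hex : ∃ ℓ ∈ {ℓ : Leaf m | u <+: List.ofFn ℓ ∧ P.out (List.ofFn ℓ) = true},
        ℓ ∈ P.leafDist.support := by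
      by_contra hne
      have hz : P.leafDist.toOuterMeasure
          {ℓ : Leaf m | u <+: List.ofFn ℓ ∧ P.out (List.ofFn ℓ) = true} = 0 := by
        rw [PMF.toOuterMeasure_apply_eq_zero_iff, Set.disjoint_left]
        exact fun ℓ h1 h2 => hne ⟨ℓ, h2, h1⟩
      rw [prob, hz] at hpos
      simp at hpos
    have hset : {ℓ : Leaf m | ℓ ∈ {ℓ : Leaf m | u <+: List.ofFn ℓ ∧ P.out (List.ofFn ℓ) = true} ∧
        (List.ofFn ℓ).getD u.length false = b} =
        {ℓ | u ++ [b] <+: List.ofFn ℓ ∧ P.out (List.ofFn ℓ) = true} := by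
      ext ℓ
      have := prefix_getD_iff (u := u) (x := List.ofFn ℓ) b (by simpa using hu)
      simp only [Set.mem_ofPred_eq, ← this]
      tauto
    have key := prob_map_filter P.leafDist _ hex
      (fun ℓ => (List.ofFn ℓ).getD u.length false) b
    rw [hset, prob_prefix_out P hu.le, prob_prefix_out P (by simpa using hu), reach_append,
      List.nil_append] at key
    rw [biasedCont, dif_pos hex]
    have : reach P.step [] u ≠ 0 := hr.ne'
    apply mul_left_cancel₀ this
    linarith

/-! ### Change of measure under biasing, and hybrid bounds. -/

/-- The right side is the tangent at `a = 1` of the left side. When `a` has mean one the linear term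
averages out, which gives the supermartingale step. The gap of `2a^(1+r)` above its tangent must be
paid by the gap `H` of `a^(2+r)` multiplied by `v`. Weighted AM-GM bounds the gap of `a^(1+r)` by `r
* H`, so `2r ≤ v` suffices. -/
lemma rpow_mul_two_sub_le {r v a : ℝ} (hr : 0 < r) (hv : 2 * r ≤ v) (ha : 0 ≤ a) :
    a ^ (1 + r) * (2 - a * v) ≤ (2 - v) + (2 * (1 + r) - v * (2 + r)) * (a - 1) := by
  have h1 : a ^ (1 + r) = a * a ^ r := Real.rpow_one_add' ha (by positivity)
  have h2 : a ^ (2 + r) = a * (a * a ^ r) := by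
    rw [← h1, ← Real.rpow_one_add' ha (by positivity)]; ring_nf
  have hB : 1 + (2 + r) * (a - 1) ≤ a * (a * a ^ r) := by
    have := one_add_mul_self_le_rpow_one_add (s := a - 1) (by linarith) (p := 2 + r) (by linarith)
    rwa [add_sub_cancel, h2] at this
  have hY : (1 + r) * a ^ r ≤ r * (a * a ^ r) + 1 := by
    have h3 := Real.geom_mean_le_arith_mean2_weighted (w₁ := r / (1 + r)) (w₂ := 1 / (1 + r))
      (p₁ := a ^ (1 + r)) (p₂ := 1) (by positivity) (by positivity) (by positivity) zero_le_one
      (by field_simp; ring)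
    rw [← Real.rpow_mul ha, mul_div_cancel₀ _ (by positivity : (1 + r) ≠ 0), Real.one_rpow,
      mul_one, mul_one, h1] at h3
    have h4 : 0 < 1 + r := by positivity
    calc (1 + r) * a ^ r ≤ (1 + r) * (r / (1 + r) * (a * a ^ r) + 1 / (1 + r)) := by gcongr
      _ = r * (a * a ^ r) + 1 := by field_simp
  rw [h1]
  set X := a ^ r
  have hY' : (1 + r) * (a * X) ≤ r * (a * (a * X)) + a := by
    calc (1 + r) * (a * X) = a * ((1 + r) * X) := by ring
      _ ≤ a * (r * (a * X) + 1) := by gcongr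
      _ = _ := by ring
  set Y := a * X
  set H := a * Y - 1 - (2 + r) * (a - 1) with hH
  have hH0 : 0 ≤ H := by linarith
  have hle : Y - 1 - (1 + r) * (a - 1) ≤ r * H := by
    have h4 : 0 < 1 + r := by positivity
    have h5 : 0 ≤ r ^ 2 * H := by positivity
    refine le_of_mul_le_mul_left ?_ h4
    rw [hH] at h5 ⊢
    linarith
  have hfin : 2 * (r * H) ≤ v * H := by nlinarith
  rw [hH] at hfin hle
  linarith

/-- Passing from a process `q` to the process `q'` that is biased by the bounded martingale `V`,
the probability of an event does not increase by much, as long as the biased steps are made at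
nodes where `V` is bounded away from zero, or after the set `L` has been visited. -/
lemma mul_ev_biased_le {q q' : List Bool → Bool → ℝ} {V : List Bool → ℝ} {L : Set (List Bool)}
    {G : List Bool → Prop} {m : ℕ} {r : ℝ} (hq : IsKernel q) (hq' : IsKernel q') (hr : 0 < r)
    (hV0 : ∀ u, 0 ≤ V u) (hV1 : ∀ u, V u ≤ 1)
    (hV : ∀ u, u.length < m → V u = q u true * V (u ++ [true]) + q u false * V (u ++ [false]))
    (hG : ∀ u b, G u → u ∉ L → u.length < m → 0 < q u b → G (u ++ [b]))
    (hstep : ∀ u, G u → u ∉ L → u.length < m → (∀ b, q' u b = q u b) ∨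
      (2 * r ≤ V u ∧ ∀ b, q' u b * V u = q u b * V (u ++ [b])))
    {g g' : List Bool → ℝ} (hg0 : ∀ x, 0 ≤ g x) (hg1 : ∀ x, g x ≤ 1) (hgg : ∀ x, g x ≤ g' x)
    (hg' : ∀ x, ∀ u ∈ L, u <+: x → 1 ≤ g' x) (n : ℕ) (u : List Bool) (z : ℝ)
    (hn : u.length + n ≤ m) (hu : G u) (hz : 0 ≤ z) :
    z * ev q' n u g ≤ ev q n u g' + z ^ (1 + r) * (2 - V u) := by
  have hg'0 : ∀ x, 0 ≤ g' x := fun x => (hg0 x).trans (hgg x)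
  -- The stopping estimate: a weight `z ≤ 1` is absorbed by `y`, a weight `z ≥ 1` by `z ≤ z^(1+r)`,
  -- using `2 - V ≥ 1`.
  have aux : ∀ (w : List Bool) (z : ℝ), 0 ≤ z → ∀ y A : ℝ, 0 ≤ y → A ≤ 1 → (A ≤ y ∨ 1 ≤ y) →
      0 ≤ A → z * A ≤ y + z ^ (1 + r) * (2 - V w) := by
    intro w z hz y A hy hA1 hAy hA
    have h1 : 0 ≤ z ^ (1 + r) := Real.rpow_nonneg hz _
    have h2 : z * A ≤ z := mul_le_of_le_one_right hz hA1
    have h3 : z ^ (1 + r) ≤ z ^ (1 + r) * (2 - V w) :=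
      le_mul_of_one_le_right h1 (by linarith [hV1 w])
    rcases le_total z 1 with h | h
    · have := mul_le_of_le_one_left hA h
      rcases hAy with h4 | h4 <;> linarith
    · have : z ≤ z ^ (1 + r) := Real.self_le_rpow_of_one_le h (by linarith)
      linarith
  induction n generalizing u z with
  | zero =>
    exact aux u z hz _ _ (hg'0 u) (hg1 u) (Or.inl (hgg u)) (hg0 u)
  | succ n ih =>
    have hum : u.length < m := by omega
    have hlen : ∀ b : Bool, (u ++ [b]).length + n ≤ m := fun b => by simp; omega
    by_cases hL : u ∈ L
    · refine aux u z hz _ _ (ev_nonneg hq hg'0) (ev_le_one hq' hg1) (Or.inr ?_) (ev_nonneg hq' hg0)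
      rw [← ev_const hq (n + 1) u 1]
      exact ev_mono_of_prefix hq fun x _ hx => hg' x u hL hx
    have IH : ∀ b z, 0 ≤ z → q u b * (z * ev q' n (u ++ [b]) g) ≤
        q u b * (ev q n (u ++ [b]) g' + z ^ (1 + r) * (2 - V (u ++ [b]))) := by
      intro b z hz
      rcases (hq.nonneg u b).eq_or_lt with h0 | h0
      · rw [← h0]; simp
      · exact mul_le_mul_of_nonneg_left (ih _ _ (hlen b) (hG u b hu hL hum h0) hz) h0.le
    have hs := hq.sum_eq_one u
    have hVu := hV u hum
    simp only [ev]
    rcases hstep u hu hL hum with h | ⟨hvr, h⟩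
    · have ht := IH true z hz
      have hf := IH false z hz
      rw [h, h, hVu]
      have : z ^ (1 + r) * (2 - (q u true * V (u ++ [true]) + q u false * V (u ++ [false]))) =
        q u true * (z ^ (1 + r) * (2 - V (u ++ [true]))) +
        q u false * (z ^ (1 + r) * (2 - V (u ++ [false]))) := by
        linear_combination (-2 * z ^ (1 + r)) * hs
      rw [this]
      linarith
    -- A biased step: the induction hypothesis is applied at the child with the weight `z`
    -- multiplied by the likelihood ratio `V (u ++ [b]) / V u`, whose `q`-mean is one (`hsum`).
    · have hVpos : 0 < V u := by linarith
      have ha : ∀ b, 0 ≤ V (u ++ [b]) / V u := fun b => div_nonneg (hV0 _) hVpos.le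
      have hqa : ∀ b, q' u b = q u b * (V (u ++ [b]) / V u) := by
        intro b
        rw [← mul_div_assoc, ← h b, mul_div_cancel_right₀ _ hVpos.ne']
      have hb : ∀ b, z * (q' u b * ev q' n (u ++ [b]) g) ≤ q u b * ev q n (u ++ [b]) g' +
          z ^ (1 + r) * (q u b * ((2 - V u) +
            (2 * (1 + r) - V u * (2 + r)) * (V (u ++ [b]) / V u - 1))) := by
        intro b
        have h1 := IH b (z * (V (u ++ [b]) / V u)) (mul_nonneg hz (ha b))
        have h2 := rpow_mul_two_sub_le hr hvr (ha b)
        rw [div_mul_cancel₀ _ hVpos.ne'] at h2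
        rw [Real.mul_rpow hz (ha b)] at h1
        have h3 := mul_le_mul_of_nonneg_left (mul_le_mul_of_nonneg_left h2 (hq.nonneg u b))
          (Real.rpow_nonneg hz (1 + r))
        rw [hqa b]
        linarith
      have ht := hb true
      have hf := hb false
      have hsum : q u true * (V (u ++ [true]) / V u) + q u false * (V (u ++ [false]) / V u) = 1 := by
        rw [← mul_div_assoc, ← mul_div_assoc, ← add_div, ← hVu, div_self hVpos.ne']
      have hid : z ^ (1 + r) * (2 - V u) =
          z ^ (1 + r) * (q u true * ((2 - V u) +
            (2 * (1 + r) - V u * (2 + r)) * (V (u ++ [true]) / V u - 1))) +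
          z ^ (1 + r) * (q u false * ((2 - V u) +
            (2 * (1 + r) - V u * (2 + r)) * (V (u ++ [false]) / V u - 1))) := by
        linear_combination (-(z ^ (1 + r) * (2 - V u)) +
          z ^ (1 + r) * (2 * (1 + r) - V u * (2 + r))) * hs -
          z ^ (1 + r) * (2 * (1 + r) - V u * (2 + r)) * hsum
      rw [hid]
      linarith

/-- Biasing towards larger values of the martingale `V` does not decrease the value. -/
lemma value_le_value_biased {q q' : List Bool → Bool → ℝ} {V V' : List Bool → ℝ}
    {S : List Bool → Prop} {m : ℕ} (hq : IsKernel q) (hV0 : ∀ u, 0 ≤ V u) (hV0' : ∀ u, 0 ≤ V' u)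
    (hV : ∀ u, u.length < m → V u = q u true * V (u ++ [true]) + q u false * V (u ++ [false]))
    (hV' : ∀ u, u.length < m →
      V' u = q' u true * V' (u ++ [true]) + q' u false * V' (u ++ [false]))
    (hend : ∀ u, u.length = m → V u = V' u)
    (hS : ∀ u b, S u → 0 < q u b → S (u ++ [b]))
    (hstep : ∀ u, S u → u.length < m → (∀ b, q' u b = q u b) ∨
      (∀ b, q' u b * V u = q u b * V (u ++ [b])))
    (n : ℕ) (u : List Bool) (hu : S u) (hn : u.length + n = m) : V u ≤ V' u := by
  induction n generalizing u with
  | zero => exact (hend u hn).le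
  | succ n ih =>
    have hum : u.length < m := by omega
    have IH : ∀ b, q u b * V (u ++ [b]) ≤ q u b * V' (u ++ [b]) := by
      intro b
      rcases (hq.nonneg u b).eq_or_lt with h0 | h0
      · rw [← h0]; simp
      · exact mul_le_mul_of_nonneg_left (ih _ (hS u b hu h0) (by simp; omega)) h0.le
    have ht := IH true
    have hf := IH false
    rcases hstep u hu hum with h | h
    · rw [hV u hum, hV' u hum, h, h]; linarith
    · rcases (hV0 u).eq_or_lt with h0 | h0
      · rw [← h0]; exact hV0' u
      refine le_of_mul_le_mul_left ?_ h0
      have e1 : V u * V' u = q u true * V' (u ++ [true]) * V (u ++ [true]) +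
          q u false * V' (u ++ [false]) * V (u ++ [false]) := by
        rw [hV' u hum]
        linear_combination V' (u ++ [true]) * h true + V' (u ++ [false]) * h false
      have h1 := mul_le_mul_of_nonneg_right ht (hV0 (u ++ [true]))
      have h2 := mul_le_mul_of_nonneg_right hf (hV0 (u ++ [false]))
      rw [e1]
      refine le_trans ?_ (add_le_add h1 h2)
      rw [hV u hum]
      have hs : q u false = 1 - q u true := by linarith [hq.sum_eq_one u]
      have hp := mul_nonneg (hq.nonneg u true) (hq.nonneg u false)
      -- The biased mean of `V` is `E[V²]/E[V]` under `q`. It is at least `E[V]` because this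
      -- variance is nonnegative.
      have := mul_nonneg hp (sq_nonneg (V (u ++ [true]) - V (u ++ [false])))
      rw [hs] at this ⊢
      nlinarith

/-- A hybrid argument: the kernels are exchanged one round at a time, and only `q` weights the nodes
at which the discrepancy is measured. -/
lemma abs_ev_sub_le {q q' : List Bool → Bool → ℝ} (hq : IsKernel q) (hq' : IsKernel q')
    {f : List Bool → ℝ} (hf : ∀ x, |f x| ≤ 1) (n : ℕ) (u : List Bool) :
    |ev q n u f - ev q' n u f| ≤
      2 * ∑ j ∈ Finset.range n, ev q j u (fun x => |q x true - q' x true|) := by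
  induction n generalizing u with
  | zero => simp [ev]
  | succ n ih =>
    have hs := hq.sum_eq_one u
    have hs' := hq'.sum_eq_one u
    rw [Finset.sum_range_succ']
    simp only [ev, Finset.sum_add_distrib, ← Finset.mul_sum]
    have ht := ih (u ++ [true])
    have hf' := ih (u ++ [false])
    set Et := ev q n (u ++ [true]) f
    set Ef := ev q n (u ++ [false]) f
    have bt : |ev q' n (u ++ [true]) f| ≤ 1 := abs_ev_le_one hq' hf
    have bf : |ev q' n (u ++ [false]) f| ≤ 1 := abs_ev_le_one hq' hf
    set Et' := ev q' n (u ++ [true]) f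
    set Ef' := ev q' n (u ++ [false]) f
    have e : q u true * Et + q u false * Ef - (q' u true * Et' + q' u false * Ef') =
        q u true * (Et - Et') + q u false * (Ef - Ef') + (q u true - q' u true) * (Et' - Ef') := by
      linear_combination (Ef') * (hs - hs')
    rw [e]
    have h1 : |q u true * (Et - Et')| = q u true * |Et - Et'| := by
      rw [abs_mul, abs_of_nonneg (hq.nonneg u true)]
    have h2 : |q u false * (Ef - Ef')| = q u false * |Ef - Ef'| := by
      rw [abs_mul, abs_of_nonneg (hq.nonneg u false)]
    have h3 : |(q u true - q' u true) * (Et' - Ef')| ≤ |q u true - q' u true| * 2 := by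
      rw [abs_mul]
      gcongr
      exact (abs_sub _ _).trans (by linarith)
    have h4 := mul_le_mul_of_nonneg_left ht (hq.nonneg u true)
    have h5 := mul_le_mul_of_nonneg_left hf' (hq.nonneg u false)
    refine (abs_add_three _ _ _).trans ?_
    linarith

/-! ### The ideal attackers: values and growth of probabilities. -/

/-- The protocol in which the left-hand party is replaced by a recursive biased-continuation
attacker. -/
noncomputable def attacked (cont : Protocol m → Continuator) (P : Protocol m) (i : ℕ) :
    Protocol m :=
  P.withAlice (recAttacker cont P i)

lemma attacked_step_B (cont : Protocol m → Continuator) (P : Protocol m) (i : ℕ) {u : List Bool}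
    (hu : P.ctrl u = Party.B) (b : Bool) :
    (attacked cont P i).step u b = (P.bob u b).toReal := by
  simp [Protocol.step, Protocol.next, attacked, Protocol.withAlice, hu]

lemma attacked_succ_step_A (cont : Protocol m → Continuator) (P : Protocol m) (i : ℕ)
    {u : List Bool} (hu : P.ctrl u = Party.A) (b : Bool) :
    (attacked cont P (i + 1)).step u b = (cont (attacked cont P i) u true b).toReal := by
  simp [Protocol.step, Protocol.next, attacked, Protocol.withAlice, hu, recAttacker]

lemma attacked_outR (cont : Protocol m → Continuator) (P : Protocol m) (i : ℕ) :
    (attacked cont P i).outR = P.outR := rfl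

open Classical in
/-- The indicator of the strings with a prefix in `L`. -/
noncomputable def hit (L : Set (List Bool)) (x : List Bool) : ℝ :=
  if ∃ v ∈ L, v <+: x then 1 else 0

lemma hit_nonneg (L : Set (List Bool)) (x : List Bool) : 0 ≤ hit L x := by
  unfold hit; split_ifs <;> norm_num

lemma hit_le_one (L : Set (List Bool)) (x : List Bool) : hit L x ≤ 1 := by
  unfold hit; split_ifs <;> norm_num

lemma hit_of_mem {L : Set (List Bool)} {u x : List Bool} (hu : u ∈ L) (hx : u <+: x) :
    hit L x = 1 := if_pos ⟨u, hu, hx⟩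

section Ideal

variable (fb : Protocol m → Continuator) (P : Protocol m)

lemma attacked_step_cases (i : ℕ) {u : List Bool} (hu : u.length < m)
    (hr : 0 < reach (attacked (biasedCont fb) P i).step [] u) :
    (∀ b, (attacked (biasedCont fb) P (i + 1)).step u b =
        (attacked (biasedCont fb) P i).step u b) ∨
      (P.ctrl u = Party.A ∧ ∀ b, (attacked (biasedCont fb) P (i + 1)).step u b *
        (attacked (biasedCont fb) P i).value u =
        (attacked (biasedCont fb) P i).step u b *
          (attacked (biasedCont fb) P i).value (u ++ [b])) := by
  cases hc : P.ctrl u with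
  | A =>
    refine Or.inr ⟨rfl, fun b => ?_⟩
    rw [attacked_succ_step_A _ _ _ hc, mul_comm]
    exact value_mul_biasedCont fb _ hu hr b
  | B => exact Or.inl fun b => by rw [attacked_step_B _ _ _ hc, attacked_step_B _ _ _ hc]

lemma value_attacked_le_succ (i : ℕ) {u : List Bool} (hu : u.length ≤ m)
    (hr : 0 < reach (attacked (biasedCont fb) P i).step [] u) :
    (attacked (biasedCont fb) P i).value u ≤ (attacked (biasedCont fb) P (i + 1)).value u := by
  refine value_le_value_biased (attacked (biasedCont fb) P i).isKernel_step
    (Protocol.value_nonneg _) (Protocol.value_nonneg _) (fun u hu => Protocol.value_eq _ hu)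
    (fun u hu => Protocol.value_eq _ hu) (fun u hu => ?_) (fun u b => reach_pos_append u b)
    (fun u hr hu => ?_) (m - u.length) u hr (by omega)
  · simp [Protocol.value, hu, ev, attacked_outR]
  · exact (attacked_step_cases fb P i hu hr).imp_right And.right

lemma attacked_zero (cont : Protocol m → Continuator) : attacked cont P 0 = P := rfl

lemma value_pos_of_notMem_lowA {η : ℝ} {u : List Bool} (hu : u.length < m)
    (hc : P.ctrl u = Party.A) (hL : u ∉ P.lowA η) : η < P.value u := by
  by_contra h
  exact hL ⟨⟨hu, P.valAt_le_value.trans (not_lt.1 h)⟩, hc⟩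

/-- At nodes that are visited before a low-value node of the left-hand party, the ideal attackers
only increase the value. -/
lemma value_le_value_attacked {η : ℝ} (hη : 0 < η) (i : ℕ) {u : List Bool} (hu : u.length ≤ m)
    (hr : 0 < reach (attacked (biasedCont fb) P i).step [] u)
    (hL : ∀ v ∈ P.lowA η, v <+: u → v = u) :
    P.value u ≤ (attacked (biasedCont fb) P i).value u := by
  induction i generalizing u with
  | zero => rfl
  | succ i ih =>
    -- Monotonicity from level `i` to `i + 1` holds only at nodes reachable at level `i`. Before `L`
    -- the level `i` value is positive at `A`'s nodes, so biasing there cannot give positive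
    -- probability to an edge that had none.
    have key : 0 < reach (attacked (biasedCont fb) P i).step [] u := by
      induction u using List.reverseRecOn with
      | nil => simp [reach]
      | append_singleton u b ihu =>
        have hul : u.length < m := by simp at hu; omega
        rw [reach_append, List.nil_append] at hr ⊢
        have h0 := (attacked (biasedCont fb) P (i + 1)).isKernel_step.nonneg u b
        have h1 : 0 < reach (attacked (biasedCont fb) P (i + 1)).step [] u :=
          pos_of_mul_pos_left hr h0
        have h2 : 0 < (attacked (biasedCont fb) P (i + 1)).step u b :=
          pos_of_mul_pos_right hr h1.le
        have hno : ∀ v ∈ P.lowA η, ¬ v <+: u := by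
          intro v hv hvu
          have h3 := hL v hv (hvu.trans (List.prefix_append _ _))
          have h4 := hvu.length_le
          rw [h3] at h4
          simp at h4
        have h3 := ihu hul.le h1 fun v hv hvu => absurd hvu (hno v hv)
        refine mul_pos h3 ?_
        rcases attacked_step_cases fb P i hul h3 with h | ⟨hc, h⟩
        · rwa [← h]
        · have h4 := ih hul.le h3 fun v hv hvu => absurd hvu (hno v hv)
          have h5 := value_pos_of_notMem_lowA P hul hc
            fun hm => hno u hm (List.prefix_refl u)
          have h6 := mul_pos h2 (hη.trans (h5.trans_le h4))
          rw [h b] at h6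
          exact pos_of_mul_pos_left h6 (Protocol.value_nonneg _ _)
    exact (ih hu key hL).trans (value_attacked_le_succ fb P i hu key)

/-- Raising the level of the ideal attacker does not make events much more likely, up to the
probability of visiting a low-value node of the left-hand party. -/
lemma ev_attacked_succ_le {η : ℝ} {N : ℕ} (hN : 0 < N) (hη : 2 * (1 / (N : ℝ)) ≤ η) {s : ℝ}
    (hs : 0 < s) (i : ℕ) {j : ℕ} (hj : j ≤ m) {g g' : List Bool → ℝ} (hg0 : ∀ x, 0 ≤ g x)
    (hg1 : ∀ x, g x ≤ 1) (hgg : ∀ x, g x ≤ g' x)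
    (hg' : ∀ x, ∀ u ∈ P.lowA η, u <+: x → 1 ≤ g' x) :
    ev (attacked (biasedCont fb) P (i + 1)).step j [] g ≤
      s ^ N * ev (attacked (biasedCont fb) P i).step j [] g' + 2 / s := by
  have hN' : (0 : ℝ) < N := by exact_mod_cast hN
  have hr : 0 < 1 / (N : ℝ) := by positivity
  have hη0 : 0 < η := by linarith
  have hnot : ∀ u b, (∀ v ∈ P.lowA η, v <+: u → v = u) → u ∉ P.lowA η →
      ∀ v ∈ P.lowA η, v <+: u ++ [b] → v = u ++ [b] := by
    intro u b h hu v hv hp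
    rcases List.prefix_concat_iff.1 hp with h1 | h1
    · exact h1
    · exact absurd (h v hv h1 ▸ hv) hu
  -- The initial weight is `z = 1 / s^N` with `r = 1/N`, so that `z^(1+r) = z / s`; dividing by `z`
  -- leaves the error `2 / s`. The invariant `G` says that the node is reachable and has no proper
  -- prefix in `L`.
  have key := mul_ev_biased_le (q := (attacked (biasedCont fb) P i).step)
    (q' := (attacked (biasedCont fb) P (i + 1)).step) (V := (attacked (biasedCont fb) P i).value)
    (L := P.lowA η) (m := m) (G := fun u => 0 < reach (attacked (biasedCont fb) P i).step [] u ∧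
      ∀ v ∈ P.lowA η, v <+: u → v = u) (Protocol.isKernel_step _) (Protocol.isKernel_step _) hr
    (Protocol.value_nonneg _) (Protocol.value_le_one _) (fun u hu => Protocol.value_eq _ hu)
    (fun u b hu hL _ hb => ⟨reach_pos_append u b hu.1 hb, hnot u b hu.2 hL⟩)
    (fun u hu hL hum => by
      refine (attacked_step_cases fb P i hum hu.1).imp_right fun h => ⟨?_, h.2⟩
      have h1 := value_pos_of_notMem_lowA P hum h.1 hL
      have h2 := value_le_value_attacked fb P hη0 i hum.le hu.1 hu.2
      linarith)
    hg0 hg1 hgg hg' j [] (1 / s ^ N) (by simpa using hj)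
    ⟨by simp [reach], fun v _ hp => List.prefix_nil.1 hp⟩ (by positivity)
  have hpow : (1 / s ^ N : ℝ) ^ (1 + 1 / (N : ℝ)) = 1 / s ^ N * (1 / s) := by
    rw [Real.rpow_one_add' (by positivity) (by positivity), ← one_div_pow,
      one_div (N : ℝ), Real.pow_rpow_inv_natCast (by positivity) hN.ne']
  rw [hpow] at key
  have hv := (attacked (biasedCont fb) P i).value_nonneg []
  have hsN : 0 < s ^ N := by positivity
  have h3 := mul_le_mul_of_nonneg_left key hsN.le
  have h4 : s ^ N * (1 / s ^ N * ev (attacked (biasedCont fb) P (i + 1)).step j [] g) =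
      ev (attacked (biasedCont fb) P (i + 1)).step j [] g := by field_simp
  have h5 : s ^ N * (1 / s ^ N * (1 / s) * (2 - (attacked (biasedCont fb) P i).value [])) =
      (2 - (attacked (biasedCont fb) P i).value []) / s := by field_simp
  have h6 : (2 - (attacked (biasedCont fb) P i).value []) / s ≤ 2 / s := by gcongr; linarith
  rw [mul_add, h4, h5] at h3
  linarith

end Ideal

/-! ### Two protocols with close leaf distributions. -/

section Compare

variable {Q R : Protocol m} {D : ℝ}

lemma ev_take_mul_outR (Q : Protocol m) {j : ℕ} (hj : j ≤ m) (s : List Bool → ℝ) :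
    ev Q.step m [] (fun x => s (x.take j) * Q.outR x) =
      ev Q.step j [] (fun u => s u * Q.value u) := by
  rw [ev_take_mul Q.isKernel_step hj]
  refine ev_congr_of_prefix Q.isKernel_step fun u hu _ => ?_
  simp only [List.length_nil, Nat.zero_add] at hu
  rw [Protocol.value, hu]

lemma ev_take_mul_getD_mul_outR (Q : Protocol m) {j : ℕ} (hj : j < m) (s : List Bool → ℝ) :
    ev Q.step m [] (fun x => s (x.take j) * (if x.getD j false = true then 1 else 0) * Q.outR x) =
      ev Q.step j [] (fun u => s u * (Q.step u true * Q.value (u ++ [true]))) := by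
  have h := ev_take_mul_outR Q (Nat.succ_le_of_lt hj)
    (fun y => s (y.take j) * (if y.getD j false = true then 1 else 0))
  have h1 : ∀ x : List Bool, (x.take (j + 1)).take j = x.take j := fun x => by
    rw [List.take_take]; simp
  have h2 : ∀ x : List Bool, (x.take (j + 1)).getD j false = x.getD j false := fun x => by
    simp [List.getD]
  simp only [Nat.succ_eq_add_one, h1, h2] at h
  rw [h, ev_comp j 1]
  refine ev_congr_of_prefix Q.isKernel_step fun u hu _ => ?_
  simp only [List.length_nil, Nat.zero_add] at hu
  subst hu
  simp [ev]
  ring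

lemma abs_ev_sub_le_mul (hD : ∀ f : List Bool → ℝ, (∀ x, |f x| ≤ 1) →
      |ev Q.step m [] f - ev R.step m [] f| ≤ D) {c : ℝ} (hc : 0 < c) {f : List Bool → ℝ}
    (hf : ∀ x, |f x| ≤ c) : |ev Q.step m [] f - ev R.step m [] f| ≤ c * D := by
  have h := hD (fun x => c⁻¹ * f x) fun x => by
    rw [abs_mul, abs_of_pos (inv_pos.2 hc), inv_mul_le_iff₀ hc, mul_one]; exact hf x
  rw [ev_const_mul, ev_const_mul, ← mul_sub, abs_mul, abs_of_pos (inv_pos.2 hc),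
    inv_mul_le_iff₀ hc] at h
  exact h

lemma ev_congr_of_reach (Q : Protocol m) {j : ℕ} {f g : List Bool → ℝ}
    (h : ∀ u, 0 < reach Q.step [] u → u.length = j → f u = g u) :
    ev Q.step j [] f = ev Q.step j [] g :=
  ev_congr_of_invariant Q.isKernel_step (fun u b => reach_pos_append u b) (by simp [reach])
    fun x hx hl _ => h x hx (by simpa using hl)

lemma ev_le_of_reach (Q : Protocol m) {j : ℕ} {f g : List Bool → ℝ}
    (h : ∀ u, 0 < reach Q.step [] u → u.length = j → f u ≤ g u) :
    ev Q.step j [] f ≤ ev Q.step j [] g :=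
  ev_le_ev_of_invariant Q.isKernel_step (fun u b => reach_pos_append u b) (by simp [reach])
    fun x hx hl _ => h x hx (by simpa using hl)

lemma abs_mul_outR_le (Q : Protocol m) {c y : ℝ} (x : List Bool) (h : |y| ≤ c) :
    |y * Q.outR x| ≤ c := by
  rw [abs_mul, abs_of_nonneg (Q.outR_nonneg x)]
  exact (mul_le_of_le_one_right (abs_nonneg _) (Q.outR_le_one x)).trans h

open Classical in
/-- The biased continuators of two protocols with close leaf distributions are close on average,
at the nodes whose value is bounded away from zero. -/
lemma ev_biasedCont_sub_le (hD : ∀ f : List Bool → ℝ, (∀ x, |f x| ≤ 1) →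
      |ev Q.step m [] f - ev R.step m [] f| ≤ D) (hout : Q.outR = R.outR)
    (fb : Protocol m → Continuator) {η : ℝ} (hη : 0 < η) {T : List Bool → Prop}
    (hT : ∀ u, T u → η ≤ Q.value u) {j : ℕ} (hj : j < m) :
    ev Q.step j [] (fun u => if T u then |(biasedCont fb Q u true true).toReal -
      (biasedCont fb R u true true).toReal| else 0) ≤ 2 * (D / η) := by
  set a : List Bool → ℝ := fun u => (biasedCont fb Q u true true).toReal with ha
  set b : List Bool → ℝ := fun u => (biasedCont fb R u true true).toReal with hb
  have hb0 : ∀ u, 0 ≤ b u := fun u => ENNReal.toReal_nonneg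
  have hb1 : ∀ u, b u ≤ 1 := fun u =>
    ENNReal.toReal_mono ENNReal.one_ne_top (PMF.coe_le_one _ _)
  -- Dividing by the value turns `|a - b|` into a difference of two leaf expectations, by
  -- `value_mul_biasedCont`. The bound on the test functions is then `1 / η`.
  set s : List Bool → ℝ := fun u => if T u then SignType.sign (a u - b u) / Q.value u else 0
    with hs
  have hsle : ∀ u, |s u| ≤ 1 / η := by
    intro u
    simp only [hs]
    split_ifs with h
    · have h1 := hT u h
      rw [abs_div, abs_of_pos (hη.trans_le h1)]
      have h2 : |((SignType.sign (a u - b u) : SignType) : ℝ)| ≤ 1 := by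
        rcases lt_trichotomy (a u - b u) 0 with h | h | h <;> simp [h]
      gcongr
    · simp; positivity
  have hη' : 0 < 1 / η := by positivity
  have e1 : ev Q.step j [] (fun u => if T u then |a u - b u| else 0) =
      ev Q.step j [] (fun u => s u * (Q.step u true * Q.value (u ++ [true]))) -
        ev Q.step j [] (fun u => (s u * b u) * Q.value u) := by
    rw [← ev_sub]
    refine ev_congr_of_reach Q fun u hu hl => ?_
    rw [← value_mul_biasedCont fb Q (by omega) hu]
    simp only [hs]
    split_ifs with h
    · have h1 := hη.trans_le (hT u h)
      have h2 : ((SignType.sign (a u - b u) : SignType) : ℝ) * (a u - b u) = |a u - b u| :=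
        sign_mul_self _
      rw [← h2]
      change _ = _ / _ * (Q.value u * a u) - _
      field_simp
    · simp
  -- Since `b` is the continuator of `R`, the same difference vanishes under `R`; hence under `Q` it
  -- is at most the cost of two exchanges of `Q` for `R`.
  have e2 : ev R.step j [] (fun u => s u * (R.step u true * R.value (u ++ [true]))) =
        ev R.step j [] (fun u => (s u * b u) * R.value u) := by
    refine ev_congr_of_reach R fun u hu hl => ?_
    rw [← value_mul_biasedCont fb R (by omega) hu]
    ring
  rw [← ev_take_mul_getD_mul_outR Q hj, ← ev_take_mul_outR Q hj.le] at e1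
  rw [← ev_take_mul_getD_mul_outR R hj, ← ev_take_mul_outR R hj.le, ← hout] at e2
  have h1 := abs_ev_sub_le_mul hD hη' (f := fun x => s (x.take j) *
    (if x.getD j false = true then 1 else 0) * Q.outR x) fun x => by
      refine abs_mul_outR_le Q x ?_
      split_ifs
      · rw [mul_one]; exact hsle _
      · simp; positivity
  have h2 := abs_ev_sub_le_mul hD hη' (f := fun x => (s (x.take j) * b (x.take j)) * Q.outR x)
    fun x => by
      refine abs_mul_outR_le Q x ?_
      rw [abs_mul, abs_of_nonneg (hb0 _)]
      exact (mul_le_of_le_one_right (abs_nonneg _) (hb1 _)).trans (hsle _)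
  have h3 := (abs_le.1 h1).2
  have h4 := (abs_le.1 h2).1
  have h5 : 1 / η * D = D / η := by ring
  rw [h5] at h3 h4
  linarith

open Classical in
/-- If the leaf distributions of two protocols are close, then it is unlikely that the values of
the two protocols are far apart at a node. -/
lemma ev_low_le (hD : ∀ f : List Bool → ℝ, (∀ x, |f x| ≤ 1) →
      |ev Q.step m [] f - ev R.step m [] f| ≤ D) (hout : Q.outR = R.outR) {η κ : ℝ}
    (hκ : κ < η) {T : List Bool → Prop}
    (hT : ∀ u, T u → η ≤ Q.value u) {j : ℕ} (hj : j ≤ m) :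
    ev Q.step j [] (fun u => if T u ∧ R.valAt u ≤ κ then 1 else 0) ≤ 2 * D / (η - κ) := by
  set I : List Bool → ℝ := fun u => if T u ∧ R.valAt u ≤ κ then 1 else 0 with hI
  have hI0 : ∀ u, 0 ≤ I u := fun u => by simp only [hI]; split_ifs <;> norm_num
  have hI1 : ∀ u, I u ≤ 1 := fun u => by simp only [hI]; split_ifs <;> norm_num
  have hv0 : ∀ u, 0 ≤ R.valAt u := fun u => R.valAt_nonneg
  have hv1 : ∀ u, R.valAt u ≤ 1 := fun u => R.valAt_le_value.trans (R.value_le_one u)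
  -- Markov-type step: on the event the two values differ by at least `η - κ`, whereas under `R` the
  -- corresponding difference is zero (`e2`).
  have e1 : (η - κ) * ev Q.step j [] I ≤
      ev Q.step j [] (fun u => I u * Q.value u) -
        ev Q.step j [] (fun u => I u * R.valAt u) := by
    rw [← ev_sub, ← ev_const_mul]
    refine ev_mono Q.isKernel_step fun u => ?_
    simp only [hI]
    split_ifs with h
    · have := hT u h.1
      linarith [h.2]
    · simp
  have e2 : ev R.step j [] (fun u => I u * R.value u) =
        ev R.step j [] (fun u => I u * R.valAt u) := by
    refine ev_congr_of_reach R fun u hu hl => ?_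
    rw [R.valAt_eq (by omega) hu]
  rw [← ev_take_mul_outR Q hj, ← ev_take Q.isKernel_step hj (fun u => I u * R.valAt u)] at e1
  rw [← ev_take_mul_outR R hj, ← ev_take R.isKernel_step hj (fun u => I u * R.valAt u),
    ← hout] at e2
  have h1 := hD (fun x => I (x.take j) * Q.outR x) fun x =>
    abs_mul_outR_le Q x (by rw [abs_of_nonneg (hI0 _)]; exact hI1 _)
  have h2 := hD (fun x => I (x.take j) * R.valAt (x.take j)) fun x => by
    rw [abs_of_nonneg (mul_nonneg (hI0 _) (hv0 _))]
    exact mul_le_one₀ (hI1 _) (hv0 _) (hv1 _)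
  rw [le_div_iff₀ (by linarith)]
  have h3 := (abs_le.1 h1).2
  have h4 := (abs_le.1 h2).1
  linarith

open Classical in
lemma ev_badly_continued_le (hD : ∀ f : List Bool → ℝ, (∀ x, |f x| ≤ 1) →
      |ev Q.step m [] f - ev R.step m [] f| ≤ D) {fb : Protocol m → Continuator} {ξ κ : ℝ}
    {C : Continuator} (hC : IsApproxBiasedCont fb ξ κ R C) {j : ℕ} (hj : j < m) :
    ev Q.step j [] (fun u => if ξ < statDist (C u true) (biasedCont fb R u true) ∧
      u ∉ R.low κ then 1 else 0) ≤ ξ + D := by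
  set I : List Bool → ℝ := fun u => if ξ < statDist (C u true) (biasedCont fb R u true) ∧
      u ∉ R.low κ then 1 else 0 with hI
  have hI1 : ∀ u, |I u| ≤ 1 := fun u => by simp only [hI]; split_ifs <;> norm_num
  have h1 := hD (fun x => I (x.take j)) fun x => hI1 _
  have h2 := hC.1
  rw [prob_leafDist R (fun x => ∃ i < m, ξ < statDist (C (x.take i) true)
    (biasedCont fb R (x.take i) true) ∧ x.take i ∉ R.low κ)] at h2
  have h3 : ev R.step m [] (fun x => I (x.take j)) ≤ ξ := by
    refine le_trans (ev_mono R.isKernel_step fun x => ?_) h2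
    simp only [hI]
    split_ifs with h h' h'
    · rfl
    · exact absurd ⟨j, hj, h⟩ h'
    · norm_num
    · rfl
  rw [← ev_take Q.isKernel_step hj.le I]
  have := (abs_le.1 h1).2
  linarith

end Compare

/-! ### One level of the recursion. -/

-- The integrand is set to one after a visit to `L`, as the change of measure to level `i + 1`
-- requires. The expectation stays at level `i`, where `hD` compares the ideal and the approximate
-- attack.
open Classical in
lemma ev_step_sub_le (fb : Protocol m → Continuator) (P : Protocol m)
    {C : Protocol m → Continuator} {d ξ D : ℝ} (hd : 0 < d) (hξ : 0 ≤ ξ)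
    (hC : ∀ Q : Protocol m, IsApproxBiasedCont fb ξ d Q (C Q)) (i : ℕ)
    (hD : ∀ f : List Bool → ℝ, (∀ x, |f x| ≤ 1) →
      |ev (attacked (biasedCont fb) P i).step m [] f - ev (attacked C P i).step m [] f| ≤ D)
    {j : ℕ} (hj : j < m) :
    ev (attacked (biasedCont fb) P i).step j [] (fun x =>
        if ∃ v ∈ P.lowA (3 / 2 * d), v <+: x then 1 else
          |(attacked (biasedCont fb) P (i + 1)).step x true - (attacked C P (i + 1)).step x true|) ≤
      ev (attacked (biasedCont fb) P i).step m [] (hit (P.lowA (3 / 2 * d))) + 2 * ξ + D +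
        16 / 3 * (D / d) := by
  set Q := attacked (biasedCont fb) P i with hQ
  set R := attacked C P i with hR
  set L := P.lowA (3 / 2 * d) with hL
  have hd' : 0 < 3 / 2 * d := by positivity
  have h1 : ev Q.step j [] (hit L) ≤ ev Q.step m [] (hit L) := by
    rw [← ev_take Q.isKernel_step hj.le (hit L)]
    refine ev_mono Q.isKernel_step fun x => ?_
    by_cases h : ∃ v ∈ L, v <+: x.take j
    · obtain ⟨v, hv, hp⟩ := h
      rw [hit_of_mem hv hp, hit_of_mem hv (hp.trans (List.take_prefix _ _))]
    · rw [hit, if_neg h]; exact hit_nonneg _ _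
  have h2 := ev_biasedCont_sub_le hD rfl fb hd' (T := fun u => 3 / 2 * d ≤ Q.value u)
    (fun u h => h) hj
  have h3 := ev_low_le hD rfl (η := 3 / 2 * d) (κ := d) (by linarith)
    (T := fun u => 3 / 2 * d ≤ Q.value u) (fun u h => h) hj.le
  have h4 := ev_badly_continued_le hD (hC R) hj
  -- Sources of error, in order: `L` has been visited; the ideal continuators of `Q` and `R` differ;
  -- the value dropped from `3d/2` under `Q` to `d` under `R`, where nothing is guaranteed; the
  -- guarantee of the approximate continuator fails; its permitted error `ξ`. The gap between `3d/2`
  -- and `d` is what makes the third unlikely.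
  refine le_trans (ev_le_of_reach Q (g := fun x => hit L x + (if 3 / 2 * d ≤ Q.value x then
      |(biasedCont fb Q x true true).toReal - (biasedCont fb R x true true).toReal| else 0) +
      (if 3 / 2 * d ≤ Q.value x ∧ R.valAt x ≤ d then 1 else 0) +
      (if ξ < statDist (C R x true) (biasedCont fb R x true) ∧ x ∉ R.low d then 1 else 0) + ξ)
      fun x hx hl => ?_) ?_
  · have n1 : 0 ≤ (if 3 / 2 * d ≤ Q.value x then |(biasedCont fb Q x true true).toReal -
        (biasedCont fb R x true true).toReal| else 0) := by
      split_ifs <;> positivity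
    have n2 : (0 : ℝ) ≤ (if 3 / 2 * d ≤ Q.value x ∧ R.valAt x ≤ d then 1 else 0) := by
      split_ifs <;> norm_num
    have n3 : (0 : ℝ) ≤ (if ξ < statDist (C R x true) (biasedCont fb R x true) ∧
        x ∉ R.low d then 1 else 0) := by
      split_ifs <;> norm_num
    have n4 := hit_nonneg L x
    have hxm : x.length < m := by omega
    by_cases h : ∃ v ∈ L, v <+: x
    · obtain ⟨v, hv, hp⟩ := id h
      rw [if_pos h, hit_of_mem hv hp]
      linarith
    rw [if_neg h]
    cases hc : P.ctrl x with
    | B =>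
      rw [attacked_step_B _ _ _ hc, attacked_step_B _ _ _ hc, sub_self, abs_zero]
      linarith
    | A =>
      have hT : 3 / 2 * d ≤ Q.value x := by
        refine (value_pos_of_notMem_lowA P hxm hc fun hm => h ⟨x, hm, List.prefix_refl x⟩).le.trans
          (value_le_value_attacked fb P hd' i hxm.le hx fun v hv hp => absurd ⟨v, hv, hp⟩ h)
      rw [attacked_succ_step_A _ _ _ hc, attacked_succ_step_A _ _ _ hc, ← hQ, ← hR]
      rw [if_pos hT] at n1 ⊢
      have htri := abs_sub_le (biasedCont fb Q x true true).toReal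
        (biasedCont fb R x true true).toReal (C R x true true).toReal
      have hsd := statDist_bool (C R x true) (biasedCont fb R x true)
      rw [abs_sub_comm] at hsd
      have hle : |(biasedCont fb R x true true).toReal - (C R x true true).toReal| ≤ 1 := by
        have b1 : (biasedCont fb R x true true).toReal ≤ 1 :=
          ENNReal.toReal_mono ENNReal.one_ne_top (PMF.coe_le_one _ _)
        have b2 : (C R x true true).toReal ≤ 1 :=
          ENNReal.toReal_mono ENNReal.one_ne_top (PMF.coe_le_one _ _)
        have b3 : 0 ≤ (biasedCont fb R x true true).toReal := ENNReal.toReal_nonneg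
        have b4 : 0 ≤ (C R x true true).toReal := ENNReal.toReal_nonneg
        rw [abs_le]; constructor <;> linarith
      rw [← hsd] at hle htri
      by_cases hs : ξ < statDist (C R x true) (biasedCont fb R x true)
      · by_cases hlow : x ∈ R.low d
        · rw [if_pos (⟨hT, hlow.2⟩ : _ ∧ _)]
          linarith
        · rw [if_pos (⟨hs, hlow⟩ : _ ∧ _)]
          linarith
      · linarith
  · rw [ev_add, ev_add, ev_add, ev_add, ev_const Q.isKernel_step]
    have e1 : 2 * (D / (3 / 2 * d)) = 4 / 3 * (D / d) := by field_simp; ring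
    have e2 : 2 * D / (3 / 2 * d - d) = 4 * (D / d) := by
      rw [show 3 / 2 * d - d = d / 2 by ring]; field_simp; ring
    rw [e1] at h2
    rw [e2] at h3
    linarith

/-- One level of the recursion: how the distance of the ideal and the approximate attacker, and
the probability that the ideal attacker visits a low-value node, increase. -/
lemma attacked_level_step (fb : Protocol m → Continuator) (P : Protocol m)
    {C : Protocol m → Continuator} {d ξ D s : ℝ} {N : ℕ} (hN : 0 < N) (hd : 0 < d)
    (hd4 : d ≤ 1 / 4) (hNd : 2 * (1 / (N : ℝ)) ≤ d) (hξ : 0 ≤ ξ) (hs : 0 < s)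
    (hC : ∀ Q : Protocol m, IsApproxBiasedCont fb ξ d Q (C Q)) (i : ℕ)
    (hit_le : ev (attacked (biasedCont fb) P i).step m [] (hit (P.lowA (3 / 2 * d))) ≤ D)
    (hD : ∀ f : List Bool → ℝ, (∀ x, |f x| ≤ 1) →
      |ev (attacked (biasedCont fb) P i).step m [] f - ev (attacked C P i).step m [] f| ≤ D) :
    ev (attacked (biasedCont fb) P (i + 1)).step m [] (hit (P.lowA (3 / 2 * d))) ≤
        2 * (m + 1) * (s ^ N * (8 * (D / d) + 2 * ξ) + 2 / s) ∧
      ∀ f : List Bool → ℝ, (∀ x, |f x| ≤ 1) →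
        |ev (attacked (biasedCont fb) P (i + 1)).step m [] f -
          ev (attacked C P (i + 1)).step m [] f| ≤
        2 * (m + 1) * (s ^ N * (8 * (D / d) + 2 * ξ) + 2 / s) := by
  classical
  have hD0 : 0 ≤ D := (ev_nonneg (Protocol.isKernel_step _) (hit_nonneg _)).trans hit_le
  have hη : 2 * (1 / (N : ℝ)) ≤ 3 / 2 * d := by linarith
  -- Here `d ≤ 1/4` lets the bare terms `D` be absorbed: `2D + (16/3)(D/d) ≤ 8(D/d)`.
  have hDd : 4 * D ≤ D / d := by
    rw [le_div_iff₀ hd]; nlinarith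
  have hm : (0 : ℝ) ≤ m := m.cast_nonneg
  set B := s ^ N * (8 * (D / d) + 2 * ξ) + 2 / s with hB
  have hB0 : 0 ≤ B := by positivity
  constructor
  -- The event of visiting `L` already contains the exceptional event of the change of measure, so
  -- `g` and `g'` coincide.
  · have h := ev_attacked_succ_le fb P hN hη hs i le_rfl (hit_nonneg (P.lowA (3 / 2 * d)))
      (hit_le_one _) (fun x => le_rfl) (fun x u hu hx => (hit_of_mem hu hx).ge)
    have h1 : ev (attacked (biasedCont fb) P i).step m [] (hit (P.lowA (3 / 2 * d))) ≤
        8 * (D / d) + 2 * ξ := by linarith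
    have h2 : s ^ N * ev (attacked (biasedCont fb) P i).step m [] (hit (P.lowA (3 / 2 * d))) ≤
        s ^ N * (8 * (D / d) + 2 * ξ) := by gcongr
    nlinarith
  · intro f hf
    refine (abs_ev_sub_le (Protocol.isKernel_step _) (Protocol.isKernel_step _) hf m []).trans ?_
    have hj : ∀ j ∈ Finset.range m, ev (attacked (biasedCont fb) P (i + 1)).step j []
        (fun x => |(attacked (biasedCont fb) P (i + 1)).step x true -
          (attacked C P (i + 1)).step x true|) ≤ B := by
      intro j hj
      rw [Finset.mem_range] at hj
      have hle : ∀ x, |(attacked (biasedCont fb) P (i + 1)).step x true -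
          (attacked C P (i + 1)).step x true| ≤ 1 := by
        intro x
        have k1 := (attacked (biasedCont fb) P (i + 1)).isKernel_step
        have k2 := (attacked C P (i + 1)).isKernel_step
        rw [abs_le]
        constructor <;> linarith [k1.nonneg x true, k2.nonneg x true, k1.le_one x true,
          k2.le_one x true]
      refine (ev_attacked_succ_le fb P hN hη hs i hj.le (fun x => abs_nonneg _) hle
        (g' := fun x => if ∃ v ∈ P.lowA (3 / 2 * d), v <+: x then 1 else
          |(attacked (biasedCont fb) P (i + 1)).step x true - (attacked C P (i + 1)).step x true|)
        (fun x => ?_) (fun x u hu hx => ?_)).trans ?_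
      · split_ifs
        exacts [hle x, le_rfl]
      · rw [if_pos ⟨u, hu, hx⟩]
      · have h := ev_step_sub_le fb P hd hξ hC i hD hj
        have h2 := h.trans (b := _) (c := 8 * (D / d) + 2 * ξ) (by linarith)
        have h3 := mul_le_mul_of_nonneg_left h2 (pow_nonneg hs.le N)
        linarith
    have := Finset.sum_le_sum hj
    rw [Finset.sum_const, Finset.card_range, nsmul_eq_mul] at this
    nlinarith

/-! ### Iteration with polynomial bounds, and return to statistical distance. -/

/-- The bounds of `attacked_level_step`, iterated: at every level they are polynomial. -/
lemma exists_polynomial_attacked_bound {δ : ℝ} (hδ : 0 < δ) (k : ℕ) :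
    ∃ p : MvPolynomial (Fin 3) ℝ, ∀ (m : ℕ) (P : Protocol m) (fb : Protocol m → Continuator)
      (α d : ℝ), δ ≤ d → d ≤ 1 / 4 →
      ev P.step m [] (hit (P.lowA (3 / 2 * d))) ≤ α →
      ∀ ξ μ : ℝ, 0 < ξ → 0 < μ → μ < 1 → ∀ C : Protocol m → Continuator,
      (∀ Q : Protocol m, IsApproxBiasedCont fb ξ d Q (C Q)) →
      ev (attacked (biasedCont fb) P k).step m [] (hit (P.lowA (3 / 2 * d))) ≤
        (α + ξ) * MvPolynomial.eval ![(m : ℝ), 1 / d, 1 / μ] p + μ ∧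
      ∀ f : List Bool → ℝ, (∀ x, |f x| ≤ 1) →
        |ev (attacked (biasedCont fb) P k).step m [] f - ev (attacked C P k).step m [] f| ≤
        (α + ξ) * MvPolynomial.eval ![(m : ℝ), 1 / d, 1 / μ] p + μ := by
  -- The exponent must satisfy `2/N ≤ d` for every admissible `d ≥ δ`. Choosing it from `δ` alone
  -- keeps `s^N` polynomial.
  obtain ⟨N, hN⟩ := exists_nat_gt (2 / δ)
  have hNpos : (0 : ℝ) < N := lt_trans (by positivity) hN
  have hN0 : 0 < N := by exact_mod_cast hNpos
  induction k with
  | zero =>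
    refine ⟨1, fun m P fb α d _ _ hα ξ μ hξ hμ _ C _ => ?_⟩
    have hα0 : 0 ≤ α := (ev_nonneg P.isKernel_step (hit_nonneg _)).trans hα
    simp only [attacked_zero, sub_self, abs_zero, map_one, mul_one]
    exact ⟨by linarith, fun _ _ => by linarith⟩
  | succ k ih =>
    obtain ⟨p, hp⟩ := ih
    let M : MvPolynomial (Fin 3) ℝ := MvPolynomial.X 0
    let y : MvPolynomial (Fin 3) ℝ := MvPolynomial.X 1
    let z : MvPolynomial (Fin 3) ℝ := MvPolynomial.X 2
    let t : MvPolynomial (Fin 3) ℝ := (8 * (M + 1) * z) ^ N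
    refine ⟨2 * (M + 1) * t *
      (8 * MvPolynomial.bind₁ ![M, y, 32 * (M + 1) * t * y * z] p * y + 2),
      fun m P fb α d hδd hd4 hα ξ μ hξ hμ hμ1 C hC => ?_⟩
    have hd : 0 < d := hδ.trans_le hδd
    have hα0 : 0 ≤ α := (ev_nonneg P.isKernel_step (hit_nonneg _)).trans hα
    have hm : (0 : ℝ) ≤ m := m.cast_nonneg
    -- Chosen so that the tail `2(m+1) * (2/s)` equals `μ/2`.
    set s : ℝ := 8 * (m + 1) * (1 / μ) with hs
    have hs0 : 0 < s := by positivity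
    have hs1 : 1 ≤ s := by
      have : 1 ≤ 1 / μ := (one_le_div hμ).2 hμ1.le
      rw [hs]; nlinarith
    have hT0 : 0 < s ^ N := by positivity
    -- The slack of the previous level, chosen so that after amplification it contributes the other
    -- `μ/2`. Its inverse is a polynomial in `m`, `1/d`, `1/μ`, which is what `MvPolynomial.bind₁`
    -- substitutes.
    set μ' : ℝ := 1 / (32 * (m + 1) * s ^ N * (1 / d) * (1 / μ)) with hμ'
    have hμ'0 : 0 < μ' := by positivity
    have hμ'1 : μ' < 1 := by
      rw [hμ', div_lt_one (by positivity)]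
      have h1 : 1 ≤ 1 / μ := (one_le_div hμ).2 hμ1.le
      have h2 : 1 ≤ 1 / d := (one_le_div hd).2 (by linarith)
      have h3 : 1 ≤ s ^ N := one_le_pow₀ hs1
      calc (1 : ℝ) < 32 * (0 + 1) * 1 * 1 * 1 := by norm_num
        _ ≤ 32 * (m + 1) * s ^ N * (1 / d) * (1 / μ) := by gcongr
    have hNd : 2 * (1 / (N : ℝ)) ≤ d := by
      refine le_trans ?_ hδd
      rw [mul_one_div, div_le_iff₀ hNpos]
      rw [div_lt_iff₀ hδ] at hN
      linarith
    obtain ⟨h1, h2⟩ := hp m P fb α d hδd hd4 hα ξ μ' hξ hμ'0 hμ'1 C hC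
    have key := attacked_level_step fb P hN0 hd hd4 hNd hξ.le hs0 hC k h1 h2
    have heval : MvPolynomial.eval ![(m : ℝ), 1 / d, 1 / μ]
        (2 * (M + 1) * t *
          (8 * MvPolynomial.bind₁ ![M, y, 32 * (M + 1) * t * y * z] p * y + 2)) =
        2 * (m + 1) * s ^ N *
          (8 * MvPolynomial.eval ![(m : ℝ), 1 / d, 1 / μ'] p * (1 / d) + 2) := by
      have hb : MvPolynomial.eval ![(m : ℝ), 1 / d, 1 / μ]
          (MvPolynomial.bind₁ ![M, y, 32 * (M + 1) * t * y * z] p) =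
          MvPolynomial.eval ![(m : ℝ), 1 / d, 1 / μ'] p := by
        have := MvPolynomial.eval₂Hom_bind₁ (RingHom.id ℝ) ![(m : ℝ), 1 / d, 1 / μ]
          ![M, y, 32 * (M + 1) * t * y * z] p
        refine this.trans ?_
        have hf : (fun i => MvPolynomial.eval₂Hom (RingHom.id ℝ) ![(m : ℝ), 1 / d, 1 / μ]
            (![M, y, 32 * (M + 1) * t * y * z] i)) = ![(m : ℝ), 1 / d, 1 / μ'] := by
          funext i
          fin_cases i
          · simp [M]
          · simp [y]
          · simp [M, y, z, t, hμ', hs]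
        rw [hf]; rfl
      simp only [map_mul, map_add, hb, map_one, map_pow, map_ofNat, M, y, z, t,
        MvPolynomial.eval_X, Matrix.cons_val_zero, Matrix.cons_val_one, Matrix.cons_val]
      rfl
    rw [heval]
    set E := MvPolynomial.eval ![(m : ℝ), 1 / d, 1 / μ'] p
    have hfin : 2 * (m + 1) * (s ^ N * (8 * (((α + ξ) * E + μ') / d) + 2 * ξ) + 2 / s) ≤
        (α + ξ) * (2 * (m + 1) * s ^ N * (8 * E * (1 / d) + 2)) + μ := by
      have e1 : 2 * ((m : ℝ) + 1) * (2 / s) = μ / 2 := by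
        rw [hs]; field_simp; norm_num
      have e2 : 2 * ((m : ℝ) + 1) * (s ^ N * (8 * (μ' / d))) = μ / 2 := by
        rw [hμ']; field_simp; norm_num
      have e3 : 0 ≤ 2 * ((m : ℝ) + 1) * (s ^ N * (2 * α)) := by positivity
      have e4 : 2 * (m + 1) * (s ^ N * (8 * (((α + ξ) * E + μ') / d) + 2 * ξ) + 2 / s) =
        (α + ξ) * (2 * (m + 1) * s ^ N * (8 * E * (1 / d) + 2)) -
          2 * ((m : ℝ) + 1) * (s ^ N * (2 * α)) +
          2 * ((m : ℝ) + 1) * (s ^ N * (8 * (μ' / d))) + 2 * ((m : ℝ) + 1) * (2 / s) := by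
        ring
      linarith
    exact ⟨key.1.trans hfin, fun f hf => (key.2 f hf).trans hfin⟩

/-- Testing against the sign of the difference of the two leaf probabilities gives their `ℓ¹`
distance, which is twice the statistical distance; the factor two is given away. -/
lemma statDist_leafDist_le {Q R : Protocol m} {D : ℝ} (hD0 : 0 ≤ D)
    (hD : ∀ f : List Bool → ℝ, (∀ x, |f x| ≤ 1) →
      |ev Q.step m [] f - ev R.step m [] f| ≤ D) : statDist Q.leafDist R.leafDist ≤ D := by
  let ofL : List Bool → Leaf m := fun x i => x.getD i false
  have hofL : ∀ ℓ : Leaf m, ofL (List.ofFn ℓ) = ℓ := fun ℓ => by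
    funext i; simp [ofL]
  let f : List Bool → ℝ := fun x =>
    SignType.sign ((Q.leafDist (ofL x)).toReal - (R.leafDist (ofL x)).toReal)
  have hf : ∀ x, |f x| ≤ 1 := by
    intro x
    simp only [f]
    rcases lt_trichotomy ((Q.leafDist (ofL x)).toReal - (R.leafDist (ofL x)).toReal) 0
      with h | h | h <;> simp [h]
  have h := hD f hf
  rw [← sum_leafDist_mul, ← sum_leafDist_mul, ← Finset.sum_sub_distrib] at h
  have h2 : ∀ ℓ : Leaf m, (Q.leafDist ℓ).toReal * f (List.ofFn ℓ) -
      (R.leafDist ℓ).toReal * f (List.ofFn ℓ) =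
      |(Q.leafDist ℓ).toReal - (R.leafDist ℓ).toReal| := by
    intro ℓ
    simp only [f, hofL]
    rw [← sub_mul, self_mul_sign]
  simp only [h2] at h
  have h3 := (abs_le.1 h).2
  rw [statDist]
  linarith

end CoinFlip

theorem mainTheorem9 (δ : ℝ) (hδ_pos : 0 < δ) (hδ_le : δ ≤ 1 / 4) (k : ℕ) :
    ∃ p : MvPolynomial (Fin 3) ℝ,
      ∀ (m : ℕ) (P : CoinFlip.Protocol m)
        -- the arbitrary answers of the ideal biased continuators
        (fb : CoinFlip.Protocol m → CoinFlip.Continuator)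
        (α δ' : ℝ), δ ≤ δ' → δ' ≤ 1 / 4 →
        CoinFlip.prob P.leafDist
          {ℓ | List.ofFn ℓ ∈ CoinFlip.desc m (P.lowA ((3 / 2) * δ'))} ≤ α →
        ∀ ξ μ : ℝ, 0 < ξ → ξ < 1 → 0 < μ → μ < 1 →
        -- an arbitrary but fixed `(ξ, δ')`-biased-continuator for each protocol
        ∀ approxCont : CoinFlip.Protocol m → CoinFlip.Continuator,
          (∀ Q : CoinFlip.Protocol m,
            CoinFlip.IsApproxBiasedCont fb ξ δ' Q (approxCont Q)) →
          CoinFlip.statDist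
              (P.withAlice (CoinFlip.idealAttacker fb P k)).leafDist
              (P.withAlice (CoinFlip.recAttacker approxCont P k)).leafDist
            ≤ (α + ξ) * MvPolynomial.eval ![(m : ℝ), 1 / δ', 1 / μ] p + μ := by
  classical
  obtain ⟨p, hp⟩ := CoinFlip.exists_polynomial_attacked_bound hδ_pos k
  refine ⟨p, fun m P fb α δ' hδ hδ4 hα ξ μ hξ _ hμ hμ1 C hC => ?_⟩
  have hα' : CoinFlip.ev P.step m [] (CoinFlip.hit (P.lowA (3 / 2 * δ'))) ≤ α := by
    refine le_trans (le_of_eq ?_) hα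
    rw [CoinFlip.prob_leafDist P (fun x => x ∈ CoinFlip.desc m (P.lowA (3 / 2 * δ')))]
    refine CoinFlip.ev_congr_of_prefix P.isKernel_step fun x hx _ => ?_
    have hxm : x.length ≤ m := by simp at hx; omega
    simp [CoinFlip.hit, CoinFlip.desc, hxm]
  obtain ⟨h1, h2⟩ := hp m P fb α δ' hδ hδ4 hα' ξ μ hξ hμ hμ1 C hC
  exact CoinFlip.statDist_leafDist_le
    ((CoinFlip.ev_nonneg (CoinFlip.Protocol.isKernel_step _) (CoinFlip.hit_nonneg _)).trans h1) h2
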